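/- Caustics on cuts and on null surfaces. Let $x=(x^1,x^2,x^3)$ be coordinates on the solution space $E^3$ (an open set $U\subset\mathbb R^3$) and let $(u,\varphi)$ be local coordinates on $E^2$. On an open set $D\subset U\times\mathbb R$ let $u,\varphi,\pi$ be smooth functions of $(x,t)$ such that for every $x$ the curve $t\mapsto(u,\varphi,\pi)(x,t)$ is a Legendrian immersion: $\partial_t u=\pi\,\partial_t\varphi$ and $(\partial_t\varphi,\partial_t\pi)\neq(0,0)$. (With $t=\pi$ this is the description $u=G-tG'$, $\varphi=-G'$ by a generating function $G(x,t)$.) The projection of this curve to the $(u,\varphi)$-plane is the cut $C_x$. Call $(x,t)\in D$ regular if $\partial_t\varphi(x,t)\ne 0$; near each regular point the cuts are graphs $u=Z(x,\varphi)$ of a smooth function $Z$, a branch of the (in general multivalued) function $Z$. Assume that $Z$ is the general solution of a third-order equation $Z'''=\Lambda(\varphi,Z,Z',Z'')$, $\Lambda$ smooth on an open set: every branch at every regular point satisfies the equation, and the $x^a$ are independent constants of integration in the sense that the covector $\lambda_a=\partial_a u-\pi\,\partial_a\varphi$ (which equals $\partial_aZ$ at regular points) and $\partial_t\lambda$, $\partial_t^2\lambda$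 are linearly independent on $D$ (for $t=\varphi$, respectively $t=\pi$: $(Z,Z',Z'')$, respectively $(G,G',G'')$, are local coordinates on $E^3$ for fixed $t$). Let $g_{ab}$ be a smooth Lorentzian metric on $U$ for which all level surfaces of $Z(\cdot,\varphi)$ are null: $g^{ab}\,\partial_aZ\,\partial_bZ=0$ at every regular point. Let $\rho=-\nabla_a l^a$, $l^a=g^{ab}\nabla_bZ(\cdot,\varphi)$, be the divergence of the null geodesic congruence generating these surfaces; $Z''$ and $\rho$ are functions on the set of regular points. Let $(x_0,t_0)\in D$, put $u_0=u(x_0,t_0)$, $\varphi_0=\varphi(x_0,t_0)$, and assume that the cut $C_{x_0}$ has regular points arbitrarily close to (or at) $t_0$. Consider the null surface $Z(x,\varphi_0)=u_0$ with all its branches, i.e. $S=\{(x,t)\in D: u(x,t)=u_0,\ \varphi(x,t)=\varphi_0\}$. Then the following are equivalent: (a) the cut $u=Z(x_0,\varphi)$ has a caustic at $\varphi_0$: $|Z''(x_0,\varphi)|\to\infty$ as $t\to t_0$ along the cut, through regular points; (b) the null surface $Z(x,\varphi_0)=u_0$ has a caustic at $x_0$: $S$ has regular points arbitrarily close to $(x_0,t_0)$,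 and $|\rho|\to\infty$ as $(x,t)\to(x_0,t_0)$ in $S$ through regular points. Moreover, if (a) holds, then $\rho$ is exactly of the order of $r=Z''$, i.e. $\rho=\Theta(r)=\Theta(s^{-1})$ with $s=1/r$, as $(x,t)\to(x_0,t_0)$ in $S$ through regular points; and for (a) to hold it suffices that $|\rho|\to\infty$ along some approach to $(x_0,t_0)$ in $S$ through regular points (for instance along a null generator of $S$). -/

import Mathlib

open Set Filter Topology Asymptotics
open scoped ContDiff

namespace NSF

/-- Local coordinates `x^a`, `a = 1, 2, 3`, on the solution space `E³`. -/
abbrev E3 : Type := Fin 3 → ℝ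

/-- The partial derivative `∂_a f` at `x`. -/
noncomputable def pd (a : Fin 3) (f : E3 → ℝ) (x : E3) : ℝ :=
  fderiv ℝ f x (Pi.single a 1)

/-- A bilinear form on `ℝ³` of Lorentzian signature, `(+,-,-)` or `(-,+,+)`. -/
def IsLorentzian (M : Matrix (Fin 3) (Fin 3) ℝ) : Prop :=
  ∃ (P : Matrix (Fin 3) (Fin 3) ℝ) (ε : ℝ), IsUnit P.det ∧ (ε = 1 ∨ ε = -1) ∧
    P.transpose * M * P = ε • Matrix.diagonal ![1, -1, -1]

/-- A smooth Lorentzian metric `g_{ab}` on a subset `U` (open, in the uses below) of `ℝ³`. -/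
structure LorentzMetric (U : Set E3) where
  g : E3 → Matrix (Fin 3) (Fin 3) ℝ
  smooth : ∀ a b, ContDiffOn ℝ ∞ (fun x => g x a b) U
  lorentzian : ∀ x ∈ U, IsLorentzian (g x)

namespace LorentzMetric

variable {U : Set E3} (g : LorentzMetric U)

/-- The inverse metric `g^{ab}`. -/
noncomputable def inv (x : E3) : Matrix (Fin 3) (Fin 3) ℝ := (g.g x)⁻¹

/-- The Christoffel symbols `Γ^c_{ab}` of the Levi-Civita connection. -/
noncomputable def christoffel (c a b : Fin 3) (x : E3) : ℝ :=
  (1 / 2) * ∑ d, g.inv x c d *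
    (pd a (fun y => g.g y d b) x + pd b (fun y => g.g y d a) x - pd d (fun y => g.g y a b) x)

/-- The gradient vector field `g^{ab} ∂_b f`. -/
noncomputable def grad (f : E3 → ℝ) (x : E3) : E3 := fun a => ∑ b, g.inv x a b * pd b f x

/-- The covariant divergence `∇_a V^a = ∂_a V^a + Γ^a_{ab} V^b`. -/
noncomputable def divergence (V : E3 → E3) (x : E3) : ℝ :=
  ∑ a, (pd a (fun y => V y a) x + ∑ b, g.christoffel a a b x * V x b)

/-- `ρ = -∇_a l^a` with `l^a = g^{ab} ∂_b f`. -/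
noncomputable def expansion (f : E3 → ℝ) (x : E3) : ℝ := -g.divergence (g.grad f) x

end LorentzMetric

/-- A smooth family, parametrised by points `x` of `E³`, of Legendrian curves
`t ↦ (u, φ, π)(x, t)` in the projective cotangent space of `E²`: each curve is an immersion on
which the contact form `du - π dφ` vanishes. The cut `C_x` is the projection of the curve to the
`(u, φ)` plane. The parametrisation `t = φ` gives graphs `u = Z(x, φ)`, `π = Z'(x, φ)`, and `t = π`
gives the curves `u = G - t G'`, `φ = -G'`, `π = t` with a generating function `G(x, t)`. -/
structure LegendrianFamily where
  D : Set (E3 × ℝ)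
  isOpen_D : IsOpen D
  u : E3 × ℝ → ℝ
  φ : E3 × ℝ → ℝ
  π : E3 × ℝ → ℝ
  smooth_u : ContDiffOn ℝ ∞ u D
  smooth_φ : ContDiffOn ℝ ∞ φ D
  smooth_π : ContDiffOn ℝ ∞ π D
  contact : ∀ q ∈ D, deriv (fun t => u (q.1, t)) q.2 = π q * deriv (fun t => φ (q.1, t)) q.2
  immersed : ∀ q ∈ D,
    ¬ (deriv (fun t => φ (q.1, t)) q.2 = 0 ∧ deriv (fun t => π (q.1, t)) q.2 = 0)

namespace LegendrianFamily

variable (L : LegendrianFamily)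

/-- The regular points of the Legendrian curves: those near which `φ` can be used as a parameter,
so that the cut is locally a graph `u = Z(x, φ)`. -/
def regular : Set (E3 × ℝ) := {q ∈ L.D | deriv (fun t => L.φ (q.1, t)) q.2 ≠ 0}

/-- The covector `∂_a u - π ∂_a φ` on `E³`. In the parametrisation `t = φ` it is `∂_a Z`, and in the
parametrisation `t = π` it is `∂_a G`. -/
noncomputable def conormal (q : E3 × ℝ) : E3 := fun a =>
  pd a (fun y => L.u (y, q.2)) q.1 - L.π q * pd a (fun y => L.φ (y, q.2)) q.1

/-- The three constants `x^a` are independent constants of integration of a third order equation: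
the covector `conormal` and its first two `t`-derivatives are linearly independent. In the
parametrisation `t = φ` this says that `(Z, Z', Z'')` are local coordinates on `E³` for fixed `φ`,
and in the parametrisation `t = π` that `(G, G', G'')` are local coordinates on `E³` for fixed `t`.
The condition does not depend on the parametrisation. -/
def IndependentConstants : Prop :=
  ∀ q ∈ L.D, LinearIndependent ℝ
    ![L.conormal q,
      deriv (fun t => L.conormal (q.1, t)) q.2,
      iteratedDeriv 2 (fun t => L.conormal (q.1, t)) q.2]

/-- `Z` collects the branches of the (in general multivalued) function `u = Z(x, φ)` given by the
cuts: for every regular point `q`, the function `Z q` is the branch through `q`. Its germ at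
`(q.1, φ q)` is determined by this condition. -/
def IsBranches (Z : E3 × ℝ → E3 → ℝ → ℝ) : Prop :=
  ∀ q ∈ L.regular, ∀ᶠ z in 𝓝 q, Z q z.1 (L.φ z) = L.u z

/-- The second derivative `Z''(x, φ)` at a regular point. -/
noncomputable def secondDeriv (Z : E3 × ℝ → E3 → ℝ → ℝ) (q : E3 × ℝ) : ℝ :=
  iteratedDeriv 2 (Z q q.1) (L.φ q)

/-- The branches solve the equation `Z''' = Λ(φ, Z, Z', Z'')`, where `Λ` is a smooth function on an
open set `Λdom`. -/
def SolvesODE (Z : E3 × ℝ → E3 → ℝ → ℝ) (Λdom : Set (ℝ × ℝ × ℝ × ℝ))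
    (Λ : ℝ × ℝ × ℝ × ℝ → ℝ) : Prop :=
  IsOpen Λdom ∧ ContDiffOn ℝ ∞ Λ Λdom ∧ ∀ q ∈ L.regular,
    (L.φ q, Z q q.1 (L.φ q), deriv (Z q q.1) (L.φ q), L.secondDeriv Z q) ∈ Λdom ∧
    iteratedDeriv 3 (Z q q.1) (L.φ q) =
      Λ (L.φ q, Z q q.1 (L.φ q), deriv (Z q q.1) (L.φ q), L.secondDeriv Z q)

/-- The multivalued function `Z` is the general solution of `Z''' = Λ(φ, Z, Z', Z'')`, and the cuts
`u = Z(x, φ)` are the projections of the Legendrian curves of the family. -/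
structure IsGeneralSolution (Z : E3 × ℝ → E3 → ℝ → ℝ) (Λdom : Set (ℝ × ℝ × ℝ × ℝ))
    (Λ : ℝ × ℝ × ℝ × ℝ → ℝ) : Prop where
  branches : L.IsBranches Z
  solves : L.SolvesODE Z Λdom Λ
  independent : L.IndependentConstants

/-- The level surfaces of `Z(·, φ)` are null: `g^{ab} ∂_a Z ∂_b Z = 0` for all `x` and `φ`. -/
def IsNull (Z : E3 × ℝ → E3 → ℝ → ℝ) {U : Set E3} (g : LorentzMetric U) : Prop :=
  ∀ q ∈ L.regular, ∑ a, ∑ b, g.inv q.1 a b *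
    pd a (fun y => Z q y (L.φ q)) q.1 * pd b (fun y => Z q y (L.φ q)) q.1 = 0

/-- The divergence `ρ = -∇_a l^a`, `l^a = g^{ab} ∂_b Z(·, φ)`, of the null geodesic congruence
generating the level surfaces of `Z(·, φ)`, at a regular point. -/
noncomputable def rho (Z : E3 × ℝ → E3 → ℝ → ℝ) {U : Set E3} (g : LorentzMetric U)
    (q : E3 × ℝ) : ℝ :=
  g.expansion (fun y => Z q y (L.φ q)) q.1

/-- The points `(x, t)` whose cut passes through `(u₀, φ₀)` at parameter `t`; their projections to
`E³` form the null surface `Z(x, φ₀) = u₀`, with all its branches. -/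
def nullSurface (u₀ φ₀ : ℝ) : Set (E3 × ℝ) := {q ∈ L.D | L.u q = u₀ ∧ L.φ q = φ₀}

/-- The filter of approach to `q₀ = (x₀, t₀)` along the cut of `x₀`, through regular points. -/
def cutFilter (q₀ : E3 × ℝ) : Filter (E3 × ℝ) :=
  𝓝[{q | q.1 = q₀.1} ∩ L.regular] q₀

/-- The filter of approach to `q₀ = (x₀, t₀)` along the null surface `Z(x, φ₀) = u₀` through `q₀`,
through regular points. -/
def surfaceFilter (q₀ : E3 × ℝ) : Filter (E3 × ℝ) :=
  𝓝[L.nullSurface (L.u q₀) (L.φ q₀) ∩ L.regular] q₀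

/-- The cut of `x₀` has a caustic at `q₀`: it is a graph near points arbitrarily close to `q₀`, and
`Z''(x₀, φ)` diverges as `q₀` is approached along the cut. -/
def CutCaustic (Z : E3 × ℝ → E3 → ℝ → ℝ) (q₀ : E3 × ℝ) : Prop :=
  (L.cutFilter q₀).NeBot ∧ Tendsto (fun q => |L.secondDeriv Z q|) (L.cutFilter q₀) atTop

/-- The null surface `Z(x, φ₀) = u₀` has a caustic at `q₀`: it has regular points arbitrarily close
to `q₀`, and `ρ` diverges as `q₀` is approached along the surface. -/
def SurfaceCaustic (Z : E3 × ℝ → E3 → ℝ → ℝ) {U : Set E3} (g : LorentzMetric U)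
    (q₀ : E3 × ℝ) : Prop :=
  (L.surfaceFilter q₀).NeBot ∧ Tendsto (fun q => |L.rho Z g q|) (L.surfaceFilter q₀) atTop

end LegendrianFamily

end NSF

/-! Both blow-ups are poles in the same function `∂_t φ`. Along the Legendrian curves a branch
satisfies `Z' = π` and `∂_a Z = λ_a`, so the chain rule gives `Z'' = ∂_t π / ∂_t φ`
(`secondDeriv_eq`) and `∂_a ∂_b Z = ∂_a λ_b - ∂_t λ_b ∂_a φ / ∂_t φ` (`pd_pd`). Hence `ρ = N / ∂_t φ
- R` with `N = g^{ab} ∂_a φ ∂_t λ_b` and `R` continuous on all of `D` (`rho_eq`). If `∂_t φ ≠ 0` at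
`q₀`, both `Z''` and `ρ` have finite limits there.

If `∂_t φ = 0` at `q₀`, the immersion condition gives `∂_t π ≠ 0`. Moreover `∂_t λ_a = -∂_t π ∂_a
φ`, so `-∂_t π N = g^{ab} ∂_t λ_a ∂_t λ_b`. Since `∂_t λ` is orthogonal to the null covector `λ` and
independent of it, Lorentzian signature makes this nonzero (`poleCoeff_ne_zero`). So `Z''` and `ρ`
are both of exact order `1 / ∂_t φ`, and each caustic condition amounts to `∂_t φ = 0` at `q₀`.

It remains to find regular points of the null surface near such a `q₀`: there `(u, φ, ∂_t φ)` is a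
submersion (`surjective_fderiv`), so `∂_t φ` takes small nonzero values while `u` and `φ` stay
fixed. -/

namespace NSF

/-! ### Partial derivatives in `(x, t)`. -/

/-- The partial derivative `∂_t f` of a function of `(x, t)`. -/
noncomputable def dt (f : E3 × ℝ → ℝ) (q : E3 × ℝ) : ℝ := fderiv ℝ f q (0, 1)

/-- The partial derivative `∂_a f` of a function of `(x, t)`. -/
noncomputable def dx (a : Fin 3) (f : E3 × ℝ → ℝ) (q : E3 × ℝ) : ℝ :=
  fderiv ℝ f q (Pi.single a 1, 0)

section Partial

variable {f h : E3 × ℝ → ℝ} {q : E3 × ℝ} {D : Set (E3 × ℝ)}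

theorem hasDerivAt_dt (hf : DifferentiableAt ℝ f q) :
    HasDerivAt (fun t => f (q.1, t)) (dt f q) q.2 := by
  have h1 : HasDerivAt (fun t : ℝ => (q.1, t)) ((0 : E3), (1 : ℝ)) q.2 :=
    (hasDerivAt_const q.2 q.1).prodMk (hasDerivAt_id q.2)
  exact HasFDerivAt.comp_hasDerivAt (f := fun t : ℝ => (q.1, t)) q.2 hf.hasFDerivAt h1

theorem pd_slice (a : Fin 3) (hf : DifferentiableAt ℝ f q) :
    pd a (fun y => f (y, q.2)) q.1 = dx a f q := by
  have h1 : HasFDerivAt (fun y : E3 => (y, q.2))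
      ((ContinuousLinearMap.id ℝ E3).prod (0 : E3 →L[ℝ] ℝ)) q.1 :=
    (hasFDerivAt_id q.1).prodMk (hasFDerivAt_const q.2 q.1)
  have h2 := HasFDerivAt.comp (f := fun y : E3 => (y, q.2)) q.1 hf.hasFDerivAt h1
  unfold pd dx
  rw [show (fun y => f (y, q.2)) = f ∘ (fun y : E3 => (y, q.2)) from rfl, h2.fderiv]
  simp

theorem fderiv_apply_eq_sum (v : E3) (s : ℝ) :
    fderiv ℝ f q (v, s) = ∑ a, v a * dx a f q + s * dt f q := by
  have hv : ((v, s) : E3 × ℝ) = ∑ a, v a • ((Pi.single a 1, 0) : E3 × ℝ) + s • (0, 1) := by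
    ext i
    · fin_cases i <;> simp [Fin.sum_univ_three]
    · simp [Fin.sum_univ_three]
  rw [hv, map_add, map_sum]
  simp only [map_smul, smul_eq_mul]
  rfl

theorem contDiffOn_fderiv_apply (hD : IsOpen D) (hf : ContDiffOn ℝ ∞ f D) (v : E3 × ℝ) :
    ContDiffOn ℝ ∞ (fun q => fderiv ℝ f q v) D :=
  (hf.fderiv_of_isOpen hD (m := ∞) (by simp)).clm_apply contDiffOn_const

theorem contDiffOn_dt (hD : IsOpen D) (hf : ContDiffOn ℝ ∞ f D) : ContDiffOn ℝ ∞ (dt f) D :=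
  contDiffOn_fderiv_apply hD hf _

theorem contDiffOn_dx (hD : IsOpen D) (hf : ContDiffOn ℝ ∞ f D) (a : Fin 3) :
    ContDiffOn ℝ ∞ (dx a f) D :=
  contDiffOn_fderiv_apply hD hf _

theorem differentiableAt_of_contDiffOn (hD : IsOpen D) (hf : ContDiffOn ℝ ∞ f D) (hq : q ∈ D) :
    DifferentiableAt ℝ f q :=
  (hf.contDiffAt (hD.mem_nhds hq)).differentiableAt (by simp)

theorem dt_mul (hf : DifferentiableAt ℝ f q) (hh : DifferentiableAt ℝ h q) :
    dt (fun z => f z * h z) q = dt f q * h q + f q * dt h q := by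
  unfold dt
  rw [fderiv_fun_mul hf hh]
  simp only [add_apply, smul_apply, smul_eq_mul]
  ring

theorem dx_mul (a : Fin 3) (hf : DifferentiableAt ℝ f q) (hh : DifferentiableAt ℝ h q) :
    dx a (fun z => f z * h z) q = dx a f q * h q + f q * dx a h q := by
  unfold dx
  rw [fderiv_fun_mul hf hh]
  simp only [add_apply, smul_apply, smul_eq_mul]
  ring

theorem dt_sub (hf : DifferentiableAt ℝ f q) (hh : DifferentiableAt ℝ h q) :
    dt (fun z => f z - h z) q = dt f q - dt h q := by
  unfold dt
  rw [fderiv_fun_sub hf hh]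
  rfl

theorem dt_congr (hfh : f =ᶠ[𝓝 q] h) : dt f q = dt h q := by
  unfold dt; rw [hfh.fderiv_eq]

theorem dx_congr (a : Fin 3) (hfh : f =ᶠ[𝓝 q] h) : dx a f q = dx a h q := by
  unfold dx; rw [hfh.fderiv_eq]

theorem dt_dx_comm (hD : IsOpen D) (hf : ContDiffOn ℝ ∞ f D) (hq : q ∈ D) (a : Fin 3) :
    dt (dx a f) q = dx a (dt f) q := by
  have hfq : ContDiffAt ℝ ∞ f q := hf.contDiffAt (hD.mem_nhds hq)
  have hd : DifferentiableAt ℝ (fderiv ℝ f) q :=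
    (hfq.fderiv_right (m := ∞) (by simp)).differentiableAt (by simp)
  have hs : IsSymmSndFDerivAt ℝ f q := hfq.isSymmSndFDerivAt (by
    rw [minSmoothness_of_isRCLikeNormedField]
    exact WithTop.coe_le_coe.2 le_top)
  have key : ∀ v w : E3 × ℝ, fderiv ℝ (fun z => fderiv ℝ f z v) q w
      = fderiv ℝ (fderiv ℝ f) q w v := by
    intro v w
    rw [fderiv_clm_apply hd (differentiableAt_const v)]
    simp
  unfold dt dx
  rw [key, key]
  exact hs _ _

end Partial

/-! ### Lorentzian linear algebra and regularity of the metric coefficients. -/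

section Metric

variable {U : Set E3}

theorem contDiffOn_det {X : Type*} [NormedAddCommGroup X] [NormedSpace ℝ X] {S : Set X}
    {M : X → Matrix (Fin 3) (Fin 3) ℝ} (hM : ∀ a b, ContDiffOn ℝ ∞ (fun x => M x a b) S) :
    ContDiffOn ℝ ∞ (fun x => (M x).det) S := by
  simp only [Matrix.det_fin_three]
  fun_prop (disch := assumption)

theorem IsLorentzian.exists_inv {M : Matrix (Fin 3) (Fin 3) ℝ} (hM : IsLorentzian M) :
    M.det ≠ 0 ∧ ∃ (P : Matrix (Fin 3) (Fin 3) ℝ) (ε : ℝ), IsUnit P.det ∧ ε ≠ 0 ∧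
      M⁻¹ = ε • (P * Matrix.diagonal ![1, -1, -1] * P.transpose) := by
  obtain ⟨P, ε, hP, hε, h⟩ := hM
  have hε0 : ε * ε = 1 := by rcases hε with rfl | rfl <;> norm_num
  have hηη : Matrix.diagonal ![(1 : ℝ), -1, -1] * Matrix.diagonal ![1, -1, -1] = 1 := by
    rw [Matrix.diagonal_mul_diagonal, ← Matrix.diagonal_one]
    congr 1
    ext i
    fin_cases i <;> simp
  have hPT : IsUnit P.transpose.det := by rwa [Matrix.det_transpose]
  have h1 : M * (ε • (P * Matrix.diagonal ![1, -1, -1] * P.transpose)) = 1 := by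
    have h2 : P.transpose * (M * (ε • (P * Matrix.diagonal ![1, -1, -1] * P.transpose)))
        = P.transpose := by
      calc _ = ε • ((P.transpose * M * P) * Matrix.diagonal ![1, -1, -1] * P.transpose) := by
            simp only [Matrix.mul_smul, Matrix.mul_assoc]
        _ = P.transpose := by
            rw [h, Matrix.smul_mul, hηη, Matrix.smul_mul, smul_smul, hε0, one_smul, one_mul]
    have h3 := congrArg (fun A => P.transpose⁻¹ * A) h2
    simpa [← Matrix.mul_assoc, Matrix.nonsing_inv_mul _ hPT] using h3
  refine ⟨?_, P, ε, hP, fun h0 => by simp [h0] at hε0, Matrix.inv_eq_right_inv h1⟩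
  intro h0
  have := congrArg Matrix.det h1
  simp [h0] at this

open scoped Matrix in
/-- A covector orthogonal to a null covector and independent of it is not null. -/
theorem IsLorentzian.inv_apply_self_ne_zero {M : Matrix (Fin 3) (Fin 3) ℝ} (hM : IsLorentzian M)
    {v w : E3} (hvw : LinearIndependent ℝ ![v, w])
    (h1 : ∑ a, ∑ b, M⁻¹ a b * v a * v b = 0)
    (h2 : ∑ a, ∑ b, M⁻¹ a b * (w a * v b + v a * w b) = 0) :
    ∑ a, ∑ b, M⁻¹ a b * w a * w b ≠ 0 := by
  obtain ⟨-, P, ε, hP, hε, h⟩ := hM.exists_inv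
  have hM' : ∀ a b, M⁻¹ a b = ε * (P a 0 * P b 0 - P a 1 * P b 1 - P a 2 * P b 2) := by
    intro a b
    rw [h]
    simp [Matrix.mul_apply, Fin.sum_univ_three, Matrix.diagonal_apply]
    left
    ring
  have hp : ∀ v w : E3, ∑ a, ∑ b, M⁻¹ a b * v a * w b
      = ε * ((v ᵥ* P) 0 * (w ᵥ* P) 0 - (v ᵥ* P) 1 * (w ᵥ* P) 1 - (v ᵥ* P) 2 * (w ᵥ* P) 2) := by
    intro v w
    simp only [hM', Matrix.vecMul, dotProduct, Fin.sum_univ_three]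
    ring
  have h2' : ∑ a, ∑ b, M⁻¹ a b * w a * v b + ∑ a, ∑ b, M⁻¹ a b * v a * w b = 0 := by
    rw [← h2]
    simp only [Fin.sum_univ_three]
    ring
  intro h3
  rw [hp] at h1 h3
  rw [hp, hp] at h2'
  set A := v ᵥ* P with hA
  set B := w ᵥ* P with hB
  have e1 := (mul_eq_zero.mp h1).resolve_left hε
  have e3 := (mul_eq_zero.mp h3).resolve_left hε
  have e2 : A 0 * B 0 - A 1 * B 1 - A 2 * B 2 = 0 := by
    have : ε * (A 0 * B 0 - A 1 * B 1 - A 2 * B 2) = 0 := by linarith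
    exact (mul_eq_zero.mp this).resolve_left hε
  have inj : Function.Injective (fun v : E3 => v ᵥ* P) :=
    Matrix.vecMul_injective_of_isUnit ((Matrix.isUnit_iff_isUnit_det P).2 hP)
  -- Lagrange's identity for the spatial parts: the square is `(A₁² + A₂²)(B₁² + B₂²) - (A₁B₁ +
  -- A₂B₂)²`, and both terms equal `A₀² B₀²`. With `A₀ ≠ 0` this forces `A₀ B = B₀ A`, against
  -- independence.
  have hc : A 1 * B 2 - A 2 * B 1 = 0 := by
    have : (A 1 * B 2 - A 2 * B 1) ^ 2 = 0 := by
      linear_combination (-(B 0) ^ 2 ) * e1 - (A 1 ^ 2 + A 2 ^ 2) * e3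
        + (A 0 * B 0 + A 1 * B 1 + A 2 * B 2) * e2
    simpa using this
  have hA0 : A 0 ≠ 0 := by
    intro h0
    have h12 : A 1 * A 1 + A 2 * A 2 = 0 := by rw [h0] at e1; linarith
    have hz : A = 0 := by
      ext i
      fin_cases i
      · exact h0
      · show A 1 = 0
        nlinarith [mul_self_nonneg (A 1), mul_self_nonneg (A 2)]
      · show A 2 = 0
        nlinarith [mul_self_nonneg (A 1), mul_self_nonneg (A 2)]
    have hv : v = 0 := inj (by simpa using hz)
    exact hvw.ne_zero 0 (by simpa using hv)
  have hlin : A 0 • w + (-B 0) • v = 0 := by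
    apply inj
    show (A 0 • w + (-B 0) • v) ᵥ* P = 0 ᵥ* P
    rw [Matrix.add_vecMul, Matrix.smul_vecMul, Matrix.smul_vecMul, Matrix.zero_vecMul,
      ← hA, ← hB]
    have hi : ∀ i, (A 0 • B + (-B 0) • A) i = A 0 * B i - B 0 * A i := by
      intro i
      simp
      ring
    ext i
    rw [hi]
    apply mul_left_cancel₀ hA0
    fin_cases i
    · simp only [Fin.zero_eta, Pi.zero_apply]
      ring
    · simp only [Fin.mk_one, Pi.zero_apply]
      linear_combination (B 1) * e1 - (A 1) * e2 - A 2 * hc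
    · simp only [Fin.reduceFinMk, Pi.zero_apply]
      linear_combination (B 2) * e1 - (A 2) * e2 + A 1 * hc
  have := (LinearIndependent.pair_iff.mp hvw (-B 0) (A 0) (by rw [← hlin]; abel)).2
  exact hA0 this

theorem LorentzMetric.contDiffOn_inv (g : LorentzMetric U) (a b : Fin 3) :
    ContDiffOn ℝ ∞ (fun x => g.inv x a b) U := by
  have hdet := contDiffOn_det g.smooth
  have hadj : ContDiffOn ℝ ∞ (fun x => (g.g x).adjugate a b) U := by
    -- An entry of the adjugate is the determinant of the matrix with one row replaced by a constant
    -- vector.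
    simp only [Matrix.adjugate_apply]
    apply contDiffOn_det
    intro i j
    by_cases hi : i = b
    · subst hi
      simp only [Matrix.updateRow_self]
      exact contDiffOn_const
    · simp only [Matrix.updateRow_ne hi]
      exact g.smooth i j
  have : ∀ x, g.inv x a b = (g.g x).det⁻¹ * (g.g x).adjugate a b := by
    intro x
    simp [LorentzMetric.inv, Matrix.inv_def]
  simp only [this]
  exact (hdet.inv fun x hx => (g.lorentzian x hx).exists_inv.1).mul hadj

theorem contDiffOn_pd {f : E3 → ℝ} (hU : IsOpen U) (hf : ContDiffOn ℝ ∞ f U) (a : Fin 3) :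
    ContDiffOn ℝ ∞ (pd a f) U :=
  (hf.fderiv_of_isOpen hU (m := ∞) (by simp)).clm_apply contDiffOn_const

theorem LorentzMetric.continuousOn_christoffel (g : LorentzMetric U) (hU : IsOpen U)
    (c a b : Fin 3) : ContinuousOn (g.christoffel c a b) U := by
  have h1 := fun a b => (g.contDiffOn_inv a b).continuousOn
  have h2 := fun c a b => (contDiffOn_pd hU (g.smooth a b) c).continuousOn
  unfold LorentzMetric.christoffel
  refine continuousOn_const.mul (continuousOn_finsetSum _ fun d _ => ?_)
  exact (h1 c d).mul (((h2 a d b).add (h2 b d a)).sub (h2 d a b))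

end Metric

/-- With `h` a branch of `Z` or one of its first derivatives, this converts derivatives in `(x, φ)`
into derivatives in `(x, t)`. -/
theorem fderiv_comp_graph {h k φ : E3 × ℝ → ℝ} {q : E3 × ℝ}
    (hh : DifferentiableAt ℝ h (q.1, φ q)) (hφ : DifferentiableAt ℝ φ q)
    (hk : ∀ᶠ z in 𝓝 q, h (z.1, φ z) = k z) :
    dt k q = dt h (q.1, φ q) * dt φ q ∧
      ∀ a, dx a k q = dx a h (q.1, φ q) + dt h (q.1, φ q) * dx a φ q := by
  have h1 : HasFDerivAt (fun z : E3 × ℝ => (z.1, φ z))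
      ((ContinuousLinearMap.fst ℝ E3 ℝ).prod (fderiv ℝ φ q)) q :=
    hasFDerivAt_fst.prodMk hφ.hasFDerivAt
  have h2 : HasFDerivAt k _ q :=
    (HasFDerivAt.comp (f := fun z : E3 × ℝ => (z.1, φ z)) q hh.hasFDerivAt h1).congr_of_eventuallyEq
      (hk.mono fun z hz => hz.symm)
  refine ⟨?_, fun a => ?_⟩
  · unfold dt
    rw [h2.fderiv]
    change fderiv ℝ h (q.1, φ q) (0, fderiv ℝ φ q (0, 1)) = _
    rw [fderiv_apply_eq_sum]
    simp [dt, mul_comm]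
  · unfold dx
    rw [h2.fderiv]
    change fderiv ℝ h (q.1, φ q) (Pi.single a 1, fderiv ℝ φ q (Pi.single a 1, 0)) = _
    rw [fderiv_apply_eq_sum]
    simp [dx, dt, Pi.single_apply, mul_comm]

/-! ### The conormal and its `t`-derivatives. -/

namespace LegendrianFamily

variable (L : LegendrianFamily)

/-- The components of the conormal as functions of `(x, t)`. -/
noncomputable def lam (a : Fin 3) (q : E3 × ℝ) : ℝ := dx a L.u q - L.π q * dx a L.φ q

variable {L} {q : E3 × ℝ}

theorem differentiableAt_u (hq : q ∈ L.D) : DifferentiableAt ℝ L.u q :=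
  differentiableAt_of_contDiffOn L.isOpen_D L.smooth_u hq

theorem differentiableAt_φ (hq : q ∈ L.D) : DifferentiableAt ℝ L.φ q :=
  differentiableAt_of_contDiffOn L.isOpen_D L.smooth_φ hq

theorem differentiableAt_π (hq : q ∈ L.D) : DifferentiableAt ℝ L.π q :=
  differentiableAt_of_contDiffOn L.isOpen_D L.smooth_π hq

theorem contDiffOn_lam (a : Fin 3) : ContDiffOn ℝ ∞ (L.lam a) L.D :=
  (contDiffOn_dx L.isOpen_D L.smooth_u a).sub
    (L.smooth_π.mul (contDiffOn_dx L.isOpen_D L.smooth_φ a))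

theorem conormal_apply (hq : q ∈ L.D) (a : Fin 3) : L.conormal q a = L.lam a q := by
  unfold conormal lam
  rw [pd_slice a (differentiableAt_u hq), pd_slice a (differentiableAt_φ hq)]

theorem dt_u (hq : q ∈ L.D) : dt L.u q = L.π q * dt L.φ q := by
  have := L.contact q hq
  rwa [(hasDerivAt_dt (differentiableAt_u hq)).deriv,
    (hasDerivAt_dt (differentiableAt_φ hq)).deriv] at this

theorem dt_π_ne_zero (hq : q ∈ L.D) (h : dt L.φ q = 0) : dt L.π q ≠ 0 := by
  have := L.immersed q hq
  rw [(hasDerivAt_dt (differentiableAt_π hq)).deriv,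
    (hasDerivAt_dt (differentiableAt_φ hq)).deriv] at this
  exact fun h' => this ⟨h, h'⟩

theorem mem_regular : q ∈ L.regular ↔ q ∈ L.D ∧ dt L.φ q ≠ 0 := by
  refine and_congr_right fun hq => ?_
  rw [(hasDerivAt_dt (differentiableAt_φ hq)).deriv]

theorem continuousOn_dt_φ : ContinuousOn (dt L.φ) L.D :=
  (contDiffOn_dt L.isOpen_D L.smooth_φ).continuousOn

theorem isOpen_regular : IsOpen L.regular := by
  have : L.regular = L.D ∩ dt L.φ ⁻¹' {0}ᶜ := by
    ext q
    exact mem_regular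
  rw [this]
  exact continuousOn_dt_φ.isOpen_inter_preimage L.isOpen_D isOpen_compl_singleton

/-- Differentiating the contact condition in `x^a` makes the mixed derivatives of `φ` cancel. Where
`∂_t φ = 0`, only `-∂_t π ∂_a φ` survives. -/
theorem dt_lam (hq : q ∈ L.D) (a : Fin 3) :
    dt (L.lam a) q = dt L.φ q * dx a L.π q - dt L.π q * dx a L.φ q := by
  have hu := contDiffOn_dx L.isOpen_D L.smooth_u a
  have hφ := contDiffOn_dx L.isOpen_D L.smooth_φ a
  have hφ' := differentiableAt_of_contDiffOn L.isOpen_D hφ hq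
  have hφt := differentiableAt_of_contDiffOn L.isOpen_D
    (contDiffOn_dt L.isOpen_D L.smooth_φ) hq
  have hπ := differentiableAt_π hq
  have h1 : dx a (dt L.u) q = dx a L.π q * dt L.φ q + L.π q * dx a (dt L.φ) q := by
    rw [← dx_mul a hπ hφt]
    apply dx_congr
    filter_upwards [L.isOpen_D.mem_nhds hq] with z hz using dt_u hz
  have h2 : dt (L.lam a) q
      = dt (dx a L.u) q - (dt L.π q * dx a L.φ q + L.π q * dt (dx a L.φ) q) := by
    rw [← dt_mul hπ hφ']
    exact dt_sub (differentiableAt_of_contDiffOn L.isOpen_D hu hq) (hπ.fun_mul hφ')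
  rw [h2, dt_dx_comm L.isOpen_D L.smooth_u hq, dt_dx_comm L.isOpen_D L.smooth_φ hq, h1]
  ring

theorem dt_dt_lam (hq : q ∈ L.D) (a : Fin 3) :
    dt (dt (L.lam a)) q = dt (dt L.φ) q * dx a L.π q + dt L.φ q * dx a (dt L.π) q
      - (dt (dt L.π) q * dx a L.φ q + dt L.π q * dx a (dt L.φ) q) := by
  have d := fun {f : E3 × ℝ → ℝ} (hf : ContDiffOn ℝ ∞ f L.D) =>
    differentiableAt_of_contDiffOn L.isOpen_D hf hq
  have h1 := d (contDiffOn_dt L.isOpen_D L.smooth_φ)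
  have h2 := d (contDiffOn_dx L.isOpen_D L.smooth_π a)
  have h3 := d (contDiffOn_dt L.isOpen_D L.smooth_π)
  have h4 := d (contDiffOn_dx L.isOpen_D L.smooth_φ a)
  have : dt (dt (L.lam a)) q
      = dt (fun z => dt L.φ z * dx a L.π z - dt L.π z * dx a L.φ z) q := by
    apply dt_congr
    filter_upwards [L.isOpen_D.mem_nhds hq] with z hz using dt_lam hz a
  rw [this, dt_sub (h1.fun_mul h2) (h3.fun_mul h4), dt_mul h1 h2, dt_mul h3 h4,
    dt_dx_comm L.isOpen_D L.smooth_φ hq, dt_dx_comm L.isOpen_D L.smooth_π hq]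

theorem eventually_slice_mem (hq : q ∈ L.D) : ∀ᶠ t in 𝓝 q.2, (q.1, t) ∈ L.D :=
  (Continuous.prodMk_right q.1).continuousAt.eventually (L.isOpen_D.mem_nhds hq)

theorem hasDerivAt_conormal (hq : q ∈ L.D) :
    HasDerivAt (fun t => L.conormal (q.1, t)) (fun a => dt (L.lam a) q) q.2 := by
  rw [hasDerivAt_pi]
  intro a
  refine (hasDerivAt_dt (differentiableAt_of_contDiffOn L.isOpen_D (contDiffOn_lam a)
    hq)).congr_of_eventuallyEq ?_
  filter_upwards [eventually_slice_mem hq] with t ht using conormal_apply ht a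

theorem IndependentConstants.linearIndependent (h : L.IndependentConstants) (hq : q ∈ L.D) :
    LinearIndependent ℝ ![fun a => L.lam a q, fun a => dt (L.lam a) q,
      fun a => dt (dt (L.lam a)) q] := by
  have h0 : L.conormal q = fun a => L.lam a q := funext fun a => conormal_apply hq a
  have h2 : iteratedDeriv 2 (fun t => L.conormal (q.1, t)) q.2 = fun a => dt (dt (L.lam a)) q := by
    rw [iteratedDeriv_succ, iteratedDeriv_one]
    refine HasDerivAt.deriv ?_
    have : HasDerivAt (fun t => fun a => dt (L.lam a) (q.1, t))
        (fun a => dt (dt (L.lam a)) q) q.2 := by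
      rw [hasDerivAt_pi]
      intro a
      exact hasDerivAt_dt (differentiableAt_of_contDiffOn L.isOpen_D
        (contDiffOn_dt L.isOpen_D (contDiffOn_lam a)) hq)
    refine this.congr_of_eventuallyEq ?_
    filter_upwards [eventually_slice_mem hq] with t ht using (hasDerivAt_conormal ht).deriv
  have := h q hq
  rwa [(hasDerivAt_conormal hq).deriv, h0, h2] at this

/-! ### Derivatives of the branches of `Z`. -/

section Branch

variable {Z : E3 × ℝ → E3 → ℝ → ℝ}

/-- At a regular point `(x, t) ↦ (x, φ)` is a local diffeomorphism by the inverse function theorem,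
and the branch is `u` composed with its inverse. -/
theorem IsBranches.contDiffAt (hZ : L.IsBranches Z) (hq : q ∈ L.regular) :
    ContDiffAt ℝ ∞ (fun w : E3 × ℝ => Z q w.1 w.2) (q.1, L.φ q) := by
  obtain ⟨hqD, hft⟩ := mem_regular.1 hq
  have hnhds := L.isOpen_D.mem_nhds hqD
  set Φ : E3 × ℝ → E3 × ℝ := fun z => (z.1, L.φ z)
  have hΦ : ContDiffAt ℝ ∞ Φ q := contDiffAt_fst.prodMk (L.smooth_φ.contDiffAt hnhds)
  set A := fderiv ℝ L.φ q
  have hAv : ∀ v s, A (v, s) = A (v, 0) + s * dt L.φ q := by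
    intro v s
    rw [show ((v, s) : E3 × ℝ) = (v, 0) + s • (0, 1) by simp, map_add, map_smul]
    rfl
  -- The derivative `(v, s) ↦ (v, A (v, 0) + s ∂_t φ)` is block triangular; its inverse solves for
  -- `s`.
  let F : (E3 × ℝ) ≃L[ℝ] (E3 × ℝ) := ContinuousLinearEquiv.equivOfInverse
    ((ContinuousLinearMap.fst ℝ E3 ℝ).prod A)
    ((ContinuousLinearMap.fst ℝ E3 ℝ).prod ((dt L.φ q)⁻¹ • (ContinuousLinearMap.snd ℝ E3 ℝ -
      A.comp ((ContinuousLinearMap.fst ℝ E3 ℝ).prod 0))))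
    (by
      rintro ⟨v, s⟩
      have := hAv v s
      ext1
      · rfl
      · change (dt L.φ q)⁻¹ * (A (v, s) - A (v, 0)) = s
        rw [this]
        field_simp
        ring)
    (by
      rintro ⟨v, s⟩
      ext1
      · rfl
      · change A (v, (dt L.φ q)⁻¹ * (s - A (v, 0))) = s
        rw [hAv]
        field_simp
        ring)
  have hF : HasFDerivAt Φ (F : E3 × ℝ →L[ℝ] E3 × ℝ) q :=
    hasFDerivAt_fst.prodMk (differentiableAt_φ hqD).hasFDerivAt
  have hs := hΦ.hasStrictFDerivAt' hF (by simp)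
  have hΨ : ContDiffAt ℝ ∞ (hs.localInverse Φ F q) (Φ q) := hΦ.to_localInverse hF (by simp)
  have hcomp : ContDiffAt ℝ ∞ (fun w => L.u (hs.localInverse Φ F q w)) (Φ q) := by
    refine ContDiffAt.comp (Φ q) ?_ hΨ
    rw [hs.localInverse_apply_image]
    exact L.smooth_u.contDiffAt hnhds
  refine hcomp.congr_of_eventuallyEq ?_
  filter_upwards [hs.localInverse_tendsto.eventually (hZ q hq), hs.eventually_right_inverse]
    with w hw hr
  have hr1 : (hs.localInverse Φ F q w).1 = w.1 := congrArg (fun p => p.1) hr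
  have hr2 : L.φ (hs.localInverse Φ F q w) = w.2 := congrArg (fun p => p.2) hr
  rw [← hw, hr1, hr2]

theorem IsBranches.eventually_differentiableAt (hZ : L.IsBranches Z) (hq : q ∈ L.regular) :
    ∀ᶠ w in 𝓝 (q.1, L.φ q), DifferentiableAt ℝ (fun w : E3 × ℝ => Z q w.1 w.2) w := by
  have h1 : ContDiffAt ℝ 1 (fun w : E3 × ℝ => Z q w.1 w.2) (q.1, L.φ q) :=
    (hZ.contDiffAt hq).of_le (by exact WithTop.coe_le_coe.2 le_top)
  filter_upwards [h1.eventually (by simp)] with w hw using hw.differentiableAt (by simp)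

theorem IsBranches.differentiableAt_fderiv_apply (hZ : L.IsBranches Z) (hq : q ∈ L.regular)
    (v : E3 × ℝ) :
    DifferentiableAt ℝ (fun w => fderiv ℝ (fun w : E3 × ℝ => Z q w.1 w.2) w v) (q.1, L.φ q) :=
  (((hZ.contDiffAt hq).fderiv_right (m := ∞) (by simp)).differentiableAt
    (by simp)).clm_apply (differentiableAt_const v)

/-- Along the Legendrian curves, the first derivatives of a branch are `π` and the conormal. -/
theorem IsBranches.eventually_fderiv (hZ : L.IsBranches Z) (hq : q ∈ L.regular) :
    ∀ᶠ z in 𝓝 q, dt (fun w : E3 × ℝ => Z q w.1 w.2) (z.1, L.φ z) = L.π z ∧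
      ∀ a, dx a (fun w : E3 × ℝ => Z q w.1 w.2) (z.1, L.φ z) = L.lam a z := by
  have hc : ContinuousAt (fun z : E3 × ℝ => (z.1, L.φ z)) q :=
    continuousAt_fst.prodMk (differentiableAt_φ hq.1).continuousAt
  filter_upwards [hc.eventually (hZ.eventually_differentiableAt hq),
    eventually_eventually_nhds.2 (hZ q hq), isOpen_regular.mem_nhds hq] with z h1 h2 h3
  obtain ⟨hzD, hft⟩ := mem_regular.1 h3
  obtain ⟨e1, e2⟩ := fderiv_comp_graph h1 (differentiableAt_φ hzD) h2
  rw [dt_u hzD] at e1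
  -- The contact condition turns the chain rule into `π ∂_t φ = Z' ∂_t φ`, and `∂_t φ ≠ 0` at
  -- regular points.
  have e3 := (mul_right_cancel₀ hft e1).symm
  refine ⟨e3, fun a => ?_⟩
  rw [lam, e2 a, e3]
  ring

/-- The `t`-derivative of `Z'(x, φ(x, t)) = π` is `Z'' ∂_t φ = ∂_t π`. -/
theorem IsBranches.secondDeriv_eq (hZ : L.IsBranches Z) (hq : q ∈ L.regular) :
    L.secondDeriv Z q = dt L.π q / dt L.φ q := by
  obtain ⟨hqD, hft⟩ := mem_regular.1 hq
  have h2 := hZ.differentiableAt_fderiv_apply hq (0, 1)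
  have h1 : L.secondDeriv Z q = dt (dt (fun w : E3 × ℝ => Z q w.1 w.2)) (q.1, L.φ q) := by
    unfold secondDeriv
    rw [iteratedDeriv_succ, iteratedDeriv_one]
    refine HasDerivAt.deriv ((hasDerivAt_dt h2).congr_of_eventuallyEq ?_)
    have hc : ContinuousAt (fun p : ℝ => (q.1, p)) (L.φ q) :=
      (Continuous.prodMk_right q.1).continuousAt
    filter_upwards [hc.eventually (hZ.eventually_differentiableAt hq)] with p hp
      using (hasDerivAt_dt hp).deriv
  rw [h1, eq_div_iff hft]
  exact ((fderiv_comp_graph h2 (differentiableAt_φ hqD)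
    ((hZ.eventually_fderiv hq).mono fun z hz => hz.1)).1).symm

theorem IsBranches.eventually_pd (hZ : L.IsBranches Z) (hq : q ∈ L.regular) (b : Fin 3) :
    ∀ᶠ y in 𝓝 q.1, pd b (fun y => Z q y (L.φ q)) y
      = dx b (fun w : E3 × ℝ => Z q w.1 w.2) (y, L.φ q) := by
  have hc : ContinuousAt (fun y : E3 => (y, L.φ q)) q.1 :=
    (Continuous.prodMk_left (L.φ q)).continuousAt
  filter_upwards [hc.eventually (hZ.eventually_differentiableAt hq)] with y hy
    using pd_slice b hy

theorem IsBranches.pd_eq (hZ : L.IsBranches Z) (hq : q ∈ L.regular) (b : Fin 3) :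
    pd b (fun y => Z q y (L.φ q)) q.1 = L.lam b q := by
  rw [(hZ.eventually_pd hq b).self_of_nhds]
  exact (hZ.eventually_fderiv hq).self_of_nhds.2 b

/-- Differentiating `∂_b Z(x, φ(x, t)) = λ_b` in `x^a` and in `t` yields two equations containing
`∂_b Z'`; eliminating it costs a factor `∂_t φ`, the source of the pole of `ρ`. -/
theorem IsBranches.pd_pd (hZ : L.IsBranches Z) (hq : q ∈ L.regular) (a b : Fin 3) :
    pd a (pd b (fun y => Z q y (L.φ q))) q.1 * dt L.φ q
      = dx a (L.lam b) q * dt L.φ q - dt (L.lam b) q * dx a L.φ q := by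
  have h2 : DifferentiableAt ℝ (dx b fun w : E3 × ℝ => Z q w.1 w.2) (q.1, L.φ q) :=
    hZ.differentiableAt_fderiv_apply hq (Pi.single b 1, 0)
  have h1 : pd a (pd b (fun y => Z q y (L.φ q))) q.1
      = dx a (dx b (fun w : E3 × ℝ => Z q w.1 w.2)) (q.1, L.φ q) := by
    rw [← pd_slice a h2]
    unfold pd
    congr 1
    exact Filter.EventuallyEq.fderiv_eq (hZ.eventually_pd hq b)
  obtain ⟨e1, e2⟩ := fderiv_comp_graph h2 (differentiableAt_φ hq.1)
    ((hZ.eventually_fderiv hq).mono fun z hz => hz.2 b)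
  rw [h1, e1, e2 a]
  ring

theorem IsBranches.differentiableAt_pd (hZ : L.IsBranches Z) (hq : q ∈ L.regular) (b : Fin 3) :
    DifferentiableAt ℝ (pd b (fun y => Z q y (L.φ q))) q.1 := by
  have h2 := hZ.differentiableAt_fderiv_apply hq (Pi.single b 1, 0)
  have h3 : DifferentiableAt ℝ (fun y : E3 => (y, L.φ q)) q.1 := by fun_prop
  refine DifferentiableAt.congr_of_eventuallyEq ?_ (hZ.eventually_pd hq b)
  exact DifferentiableAt.comp (g := dx b (fun w : E3 × ℝ => Z q w.1 w.2)) q.1 h2 h3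

end Branch

end LegendrianFamily

/-! ### The pole of `ρ` in `∂_t φ` and its coefficient. -/

namespace LegendrianFamily

variable {L : LegendrianFamily} {q : E3 × ℝ} {Z : E3 × ℝ → E3 → ℝ → ℝ} {U : Set E3}
  {g : LorentzMetric U}

/-- Nullness is known only at regular points; this carries its consequences to the points where `∂_t
φ = 0`. -/
theorem eq_zero_of_mem_closure {f : E3 × ℝ → ℝ} (hf : ContinuousOn f L.D)
    (h0 : ∀ z ∈ L.regular, f z = 0) (hq : q ∈ L.D) (hqc : q ∈ closure L.regular) : f q = 0 := by
  have : (𝓝[L.regular] q).NeBot := mem_closure_iff_nhdsWithin_neBot.1 hqc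
  have h1 : Tendsto f (𝓝[L.regular] q) (𝓝 (f q)) :=
    (hf.continuousAt (L.isOpen_D.mem_nhds hq)).tendsto.mono_left nhdsWithin_le_nhds
  have h2 : Tendsto f (𝓝[L.regular] q) (𝓝 0) :=
    tendsto_const_nhds.congr' (eventually_nhdsWithin_of_forall fun z hz => (h0 z hz).symm)
  exact tendsto_nhds_unique h1 h2

theorem continuousOn_comp_fst {f : E3 → ℝ} (hf : ContinuousOn f U) (hLU : ∀ q ∈ L.D, q.1 ∈ U) :
    ContinuousOn (fun q : E3 × ℝ => f q.1) L.D :=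
  hf.comp continuousOn_fst hLU

theorem null_conormal (hZ : L.IsBranches Z) (hnull : L.IsNull Z g) (hq : q ∈ L.regular) :
    ∑ a, ∑ b, g.inv q.1 a b * L.lam a q * L.lam b q = 0 := by
  have := hnull q hq
  simpa only [hZ.pd_eq hq] using this

/-- The metric does not depend on `t` and the regular set is open, so `g^{ab} λ_a λ_b = 0` can be
differentiated along the curve. -/
theorem conormal_orthogonal_dt (hZ : L.IsBranches Z) (hnull : L.IsNull Z g) (hq : q ∈ L.regular) :
    ∑ a, ∑ b, g.inv q.1 a b * (dt (L.lam a) q * L.lam b q + L.lam a q * dt (L.lam b) q) = 0 := by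
  have hl := fun a => hasDerivAt_dt (differentiableAt_of_contDiffOn L.isOpen_D
    (contDiffOn_lam a) hq.1)
  have h1 : HasDerivAt
      (fun t => ∑ a, ∑ b, g.inv q.1 a b * (L.lam a (q.1, t) * L.lam b (q.1, t)))
      (∑ a, ∑ b, g.inv q.1 a b * (dt (L.lam a) q * L.lam b q + L.lam a q * dt (L.lam b) q)) q.2 :=
    HasDerivAt.fun_sum fun a _ => HasDerivAt.fun_sum fun b _ =>
      ((hl a).fun_mul (hl b)).const_mul _
  refine h1.unique ((hasDerivAt_const q.2 (0 : ℝ)).congr_of_eventuallyEq ?_)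
  have hc : ContinuousAt (fun t : ℝ => (q.1, t)) q.2 := (Continuous.prodMk_right q.1).continuousAt
  filter_upwards [hc.eventually (isOpen_regular.mem_nhds hq)] with t ht
  simpa only [mul_assoc] using null_conormal hZ hnull ht

/-- The quantity `g^{ab} ∂_a φ ∂_t λ_b`, the coefficient of the pole of `ρ` in `∂_t φ`. -/
noncomputable def poleCoeff (L : LegendrianFamily) (g : LorentzMetric U) (q : E3 × ℝ) : ℝ :=
  ∑ a, ∑ b, g.inv q.1 a b * dt (L.lam b) q * dx a L.φ q

/-- The part of `-ρ` that is regular on the whole family. -/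
noncomputable def regularPart (L : LegendrianFamily) (g : LorentzMetric U) (q : E3 × ℝ) : ℝ :=
  ∑ a, ((∑ b, (pd a (fun y => g.inv y a b) q.1 * L.lam b q + g.inv q.1 a b * dx a (L.lam b) q))
    + ∑ b, g.christoffel a a b q.1 * ∑ c, g.inv q.1 b c * L.lam c q)

theorem continuousOn_poleCoeff (hLU : ∀ q ∈ L.D, q.1 ∈ U) : ContinuousOn (L.poleCoeff g) L.D := by
  refine continuousOn_finsetSum _ fun a _ => continuousOn_finsetSum _ fun b _ => ?_
  exact ((continuousOn_comp_fst (g.contDiffOn_inv a b).continuousOn hLU).mul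
    (contDiffOn_dt L.isOpen_D (contDiffOn_lam b)).continuousOn).mul
    (contDiffOn_dx L.isOpen_D L.smooth_φ a).continuousOn

theorem continuousOn_regularPart (hU : IsOpen U) (hLU : ∀ q ∈ L.D, q.1 ∈ U) :
    ContinuousOn (L.regularPart g) L.D := by
  have hi := fun a b => continuousOn_comp_fst (g.contDiffOn_inv a b).continuousOn hLU
  have hl := fun a => (contDiffOn_lam (L := L) a).continuousOn
  refine continuousOn_finsetSum _ fun a _ => ContinuousOn.add
    (continuousOn_finsetSum _ fun b _ => ContinuousOn.add ?_ ?_)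
    (continuousOn_finsetSum _ fun b _ => ContinuousOn.mul ?_
      (continuousOn_finsetSum _ fun c _ => (hi b c).mul (hl c)))
  · exact (continuousOn_comp_fst
      (contDiffOn_pd hU (g.contDiffOn_inv a b) a).continuousOn hLU).mul (hl b)
  · exact (hi a b).mul (contDiffOn_dx L.isOpen_D (contDiffOn_lam b) a).continuousOn
  · exact continuousOn_comp_fst (g.continuousOn_christoffel hU a a b) hLU

theorem pd_mul {f h : E3 → ℝ} {x : E3} (a : Fin 3) (hf : DifferentiableAt ℝ f x)
    (hh : DifferentiableAt ℝ h x) :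
    pd a (fun y => f y * h y) x = pd a f x * h x + f x * pd a h x := by
  unfold pd
  rw [fderiv_fun_mul hf hh]
  simp only [add_apply, smul_apply, smul_eq_mul]
  ring

theorem pd_sum {f : Fin 3 → E3 → ℝ} {x : E3} (a : Fin 3)
    (hf : ∀ b, DifferentiableAt ℝ (f b) x) :
    pd a (fun y => ∑ b, f b y) x = ∑ b, pd a (f b) x := by
  unfold pd
  rw [fderiv_fun_sum fun b _ => hf b]
  simp

/-- Second derivatives of `Z` enter the divergence only through `g^{ab} ∂_a ∂_b Z`, and `pd_pd`
isolates their singular part; the remaining terms contain only `λ`, `∂_a λ_b` and the metric. -/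
theorem rho_eq (hU : IsOpen U) (hLU : ∀ q ∈ L.D, q.1 ∈ U) (hZ : L.IsBranches Z)
    (hq : q ∈ L.regular) :
    L.rho Z g q = L.poleCoeff g q / dt L.φ q - L.regularPart g q := by
  obtain ⟨hqD, hft⟩ := mem_regular.1 hq
  have hi : ∀ a b, DifferentiableAt ℝ (fun y => g.inv y a b) q.1 := fun a b =>
    ((g.contDiffOn_inv a b).contDiffAt (hU.mem_nhds (hLU q hqD))).differentiableAt (by simp)
  set f : E3 → ℝ := fun y => Z q y (L.φ q)
  have hdiv : ∀ a, pd a (fun y => g.grad f y a) q.1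
      = ∑ b, (pd a (fun y => g.inv y a b) q.1 * L.lam b q
        + g.inv q.1 a b * pd a (pd b f) q.1) := by
    intro a
    unfold LorentzMetric.grad
    rw [pd_sum a fun b => (hi a b).fun_mul (hZ.differentiableAt_pd hq b)]
    refine Finset.sum_congr rfl fun b _ => ?_
    rw [pd_mul a (hi a b) (hZ.differentiableAt_pd hq b), hZ.pd_eq hq]
  have hgrad : ∀ b, g.grad f q.1 b = ∑ c, g.inv q.1 b c * L.lam c q := fun b =>
    Finset.sum_congr rfl fun c _ => by rw [hZ.pd_eq hq]
  have hpp : ∀ a b, pd a (pd b f) q.1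
      = dx a (L.lam b) q - dt (L.lam b) q * dx a L.φ q / dt L.φ q := by
    intro a b
    rw [eq_sub_iff_add_eq, ← mul_left_inj' hft, add_mul, hZ.pd_pd hq, div_mul_cancel₀ _ hft]
    ring
  change -(∑ a, (pd a (fun y => g.grad f y a) q.1
    + ∑ b, g.christoffel a a b q.1 * g.grad f q.1 b)) = _
  unfold poleCoeff regularPart
  simp only [hdiv, hgrad, hpp, Finset.sum_div, ← Finset.sum_sub_distrib, ← Finset.sum_neg_distrib]
  refine Finset.sum_congr rfl fun a _ => ?_
  rw [← sub_sub, ← Finset.sum_sub_distrib, neg_add, ← Finset.sum_neg_distrib, ← sub_eq_add_neg]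
  congr 1
  refine Finset.sum_congr rfl fun b _ => ?_
  ring

/-- Where `∂_t φ = 0`, the coefficient times `-∂_t π` is the norm of `∂_t λ`, which cannot vanish
since `∂_t λ` is orthogonal to the null `λ` and independent of it. -/
theorem poleCoeff_ne_zero (hLU : ∀ q ∈ L.D, q.1 ∈ U) (hZ : L.IsBranches Z)
    (hind : L.IndependentConstants) (hnull : L.IsNull Z g) (hq : q ∈ L.D)
    (hqc : q ∈ closure L.regular) (hft : dt L.φ q = 0) : L.poleCoeff g q ≠ 0 := by
  have hi := fun a b => continuousOn_comp_fst (g.contDiffOn_inv a b).continuousOn hLU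
  have hl := fun a => (contDiffOn_lam (L := L) a).continuousOn
  have hlt := fun a => (contDiffOn_dt L.isOpen_D (contDiffOn_lam (L := L) a)).continuousOn
  have h1 : ∑ a, ∑ b, g.inv q.1 a b * L.lam a q * L.lam b q = 0 :=
    eq_zero_of_mem_closure
      (continuousOn_finsetSum _ fun a _ => continuousOn_finsetSum _ fun b _ =>
        ((hi a b).mul (hl a)).mul (hl b))
      (fun z hz => null_conormal hZ hnull hz) hq hqc
  have h2 : ∑ a, ∑ b,
      g.inv q.1 a b * (dt (L.lam a) q * L.lam b q + L.lam a q * dt (L.lam b) q) = 0 :=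
    eq_zero_of_mem_closure
      (continuousOn_finsetSum _ fun a _ => continuousOn_finsetSum _ fun b _ =>
        (hi a b).mul (((hlt a).mul (hl b)).add ((hl a).mul (hlt b))))
      (fun z hz => conormal_orthogonal_dt hZ hnull hz) hq hqc
  have hli : LinearIndependent ℝ ![fun a => L.lam a q, fun a => dt (L.lam a) q] := by
    have := (hind.linearIndependent hq).comp ![0, 1] (by decide)
    convert this using 1
    ext i
    fin_cases i <;> rfl
  have h3 := (g.lorentzian q.1 (hLU q hq)).inv_apply_self_ne_zero hli h1 h2
  intro h0
  apply h3
  have : ∑ a, ∑ b, (g.g q.1)⁻¹ a b * dt (L.lam a) q * dt (L.lam b) q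
      = -dt L.π q * L.poleCoeff g q := by
    unfold poleCoeff
    simp only [Finset.mul_sum]
    refine Finset.sum_congr rfl fun a _ => Finset.sum_congr rfl fun b _ => ?_
    rw [dt_lam hq a, hft, LorentzMetric.inv]
    ring
  rw [this, h0, mul_zero]

/-- At a point where `∂_t φ` vanishes, `(u, φ, ∂_t φ)` is a submersion. -/
theorem surjective_fderiv (hind : L.IndependentConstants) (hq : q ∈ L.D) (hft : dt L.φ q = 0) :
    Function.Surjective ((fderiv ℝ L.u q).prod ((fderiv ℝ L.φ q).prod (fderiv ℝ (dt L.φ) q))) := by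
  have hpt := dt_π_ne_zero hq hft
  let M : Matrix (Fin 3) (Fin 3) ℝ := Matrix.of ![fun a => L.lam a q, fun a => dt (L.lam a) q,
    fun a => dt (dt (L.lam a)) q]
  have hMu : IsUnit M := Matrix.linearIndependent_rows_iff_isUnit.1 (hind.linearIndependent hq)
  have hsurj : ∀ α β γ : ℝ, ∃ v : E3, ∑ a, v a * L.lam a q = α ∧ ∑ a, v a * dt (L.lam a) q = β ∧
      ∑ a, v a * dt (dt (L.lam a)) q = γ := by
    intro α β γ
    obtain ⟨v, hv⟩ := Matrix.mulVec_surjective_iff_isUnit.2 hMu ![α, β, γ]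
    have e : ∀ i, ∑ a, v a * M i a = ![α, β, γ] i := by
      intro i
      rw [← hv, Matrix.mulVec, dotProduct]
      exact Finset.sum_congr rfl fun a _ => mul_comm _ _
    exact ⟨v, e 0, e 1, e 2⟩
  have key : ∀ v : E3, ∀ s : ℝ,
      fderiv ℝ L.u q (v, s) = ∑ a, v a * L.lam a q + L.π q * ∑ a, v a * dx a L.φ q ∧
      fderiv ℝ L.φ q (v, s) = ∑ a, v a * dx a L.φ q ∧
      ∑ a, v a * dt (L.lam a) q = -dt L.π q * ∑ a, v a * dx a L.φ q ∧
      ∑ a, v a * dt (dt (L.lam a)) q = dt (dt L.φ) q * ∑ a, v a * dx a L.π q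
        - dt (dt L.π) q * ∑ a, v a * dx a L.φ q - dt L.π q * ∑ a, v a * dx a (dt L.φ) q := by
    intro v s
    refine ⟨?_, ?_, ?_, ?_⟩
    · rw [fderiv_apply_eq_sum, dt_u hq, hft]
      simp only [lam, Fin.sum_univ_three]
      ring
    · rw [fderiv_apply_eq_sum, hft]
      ring
    · simp only [dt_lam hq, hft, Fin.sum_univ_three]
      ring
    · simp only [dt_dt_lam hq, hft, Fin.sum_univ_three]
      ring
  rintro ⟨r₁, r₂, r₃⟩
  -- The values to prescribe for `λ`, `∂_t λ`, `∂_t² λ` on `v` come from solving `key` for `du =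
  -- r₁`, `dφ = r₂`, `d(∂_t φ) = r₃`, leaving out the `∂_t² φ` terms.
  obtain ⟨v, h1, h2, h3⟩ := hsurj (r₁ - L.π q * r₂) (-dt L.π q * r₂)
    (-dt (dt L.π) q * r₂ - dt L.π q * r₃)
  have hr2 : ∑ a, v a * dx a L.φ q = r₂ := by
    rw [(key v 0).2.2.1] at h2
    exact mul_left_cancel₀ (neg_ne_zero.2 hpt) h2
  have h4 := (key v 0).2.2.2
  rw [h3, hr2] at h4
  -- The `t`-direction affects neither `du` nor `dφ`, since `∂_t u = ∂_t φ = 0` here. If `∂_t² φ ≠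
  -- 0`, it corrects the third component; otherwise `h4` already gives the value `r₃`.
  obtain ⟨s, hs⟩ : ∃ s : ℝ, ∑ a, v a * dx a (dt L.φ) q + s * dt (dt L.φ) q = r₃ := by
    by_cases h : dt (dt L.φ) q = 0
    · refine ⟨0, mul_left_cancel₀ hpt ?_⟩
      rw [h] at h4
      linarith
    · exact ⟨(r₃ - ∑ a, v a * dx a (dt L.φ) q) / dt (dt L.φ) q, by field_simp; ring⟩
  refine ⟨(v, s), ?_⟩
  simp only [ContinuousLinearMap.prod_apply]
  rw [(key v s).1, (key v s).2.1, fderiv_apply_eq_sum, hs, h1, hr2, sub_add_cancel]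

/-- A submersion maps neighbourhoods onto neighbourhoods, so values `(u₀, φ₀, ε)` with `ε ≠ 0` small
are attained arbitrarily close to `q`. -/
theorem surfaceFilter_neBot (hind : L.IndependentConstants) (hq : q ∈ L.D)
    (hft : dt L.φ q = 0) : (L.surfaceFilter q).NeBot := by
  have hnhds := L.isOpen_D.mem_nhds hq
  have hs : HasStrictFDerivAt (fun z => (L.u z, L.φ z, dt L.φ z))
      ((fderiv ℝ L.u q).prod ((fderiv ℝ L.φ q).prod (fderiv ℝ (dt L.φ) q))) q :=
    ((L.smooth_u.contDiffAt hnhds).hasStrictFDerivAt (by simp)).prodMk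
      (((L.smooth_φ.contDiffAt hnhds).hasStrictFDerivAt (by simp)).prodMk
        (((contDiffOn_dt L.isOpen_D L.smooth_φ).contDiffAt hnhds).hasStrictFDerivAt (by simp)))
  have hmap := hs.map_nhds_eq_of_surj (LinearMap.range_eq_top.2 (surjective_fderiv hind hq hft))
  have hfreq : ∃ᶠ p in 𝓝 (L.u q, L.φ q, dt L.φ q), p.1 = L.u q ∧ p.2.1 = L.φ q ∧ p.2.2 ≠ 0 := by
    have hc : Tendsto (fun ε : ℝ => (L.u q, L.φ q, ε)) (𝓝[≠] 0)
        (𝓝 (L.u q, L.φ q, dt L.φ q)) := by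
      rw [hft]
      exact Tendsto.mono_left (Continuous.tendsto (by fun_prop) 0) nhdsWithin_le_nhds
    refine hc.frequently (Eventually.frequently ?_)
    filter_upwards [self_mem_nhdsWithin] with ε hε using ⟨rfl, rfl, hε⟩
  rw [← hmap, frequently_map] at hfreq
  rw [surfaceFilter, ← mem_closure_iff_nhdsWithin_neBot, mem_closure_iff_frequently]
  refine (hfreq.and_eventually hnhds).mono fun z hz => ?_
  exact ⟨⟨hz.2, hz.1.1, hz.1.2.1⟩, mem_regular.2 ⟨hz.2, hz.1.2.2⟩⟩

/-! ### Asymptotics of functions of the form `n / ∂_t φ - r`. -/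

section Asymptotic

variable {q₀ : E3 × ℝ} {F : Filter (E3 × ℝ)}

theorem tendsto_of_continuousOn {f : E3 × ℝ → ℝ} (hf : ContinuousOn f L.D) (hq₀ : q₀ ∈ L.D)
    (hF : F ≤ 𝓝[L.regular] q₀) : Tendsto f F (𝓝 (f q₀)) :=
  (hf.continuousAt (L.isOpen_D.mem_nhds hq₀)).tendsto.mono_left (hF.trans nhdsWithin_le_nhds)

/-- If `∂_t φ` were nonzero at `q₀`, then `f` would have a finite limit there along any nontrivial
filter. -/
theorem dt_φ_eq_zero_of_tendsto {f n r : E3 × ℝ → ℝ} (hn : ContinuousOn n L.D)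
    (hr : ContinuousOn r L.D) (hf : ∀ q ∈ L.regular, f q = n q / dt L.φ q - r q)
    (hq₀ : q₀ ∈ L.D) (hF : F ≤ 𝓝[L.regular] q₀) [F.NeBot]
    (h : Tendsto (fun q => |f q|) F atTop) : dt L.φ q₀ = 0 := by
  by_contra h0
  have h1 : Tendsto (fun q => |n q / dt L.φ q - r q|) F (𝓝 |n q₀ / dt L.φ q₀ - r q₀|) :=
    (((tendsto_of_continuousOn hn hq₀ hF).div
      (tendsto_of_continuousOn continuousOn_dt_φ hq₀ hF) h0).sub
      (tendsto_of_continuousOn hr hq₀ hF)).abs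
  refine not_tendsto_nhds_of_tendsto_atTop h _ (h1.congr' ?_)
  filter_upwards [hF self_mem_nhdsWithin] with q hq
  rw [hf q hq]

/-- The product `f ∂_t φ = n - r ∂_t φ` tends to `n q₀ ≠ 0`. -/
theorem isTheta_inv_dt_φ {f n r : E3 × ℝ → ℝ} (hn : ContinuousOn n L.D)
    (hr : ContinuousOn r L.D) (hf : ∀ q ∈ L.regular, f q = n q / dt L.φ q - r q)
    (hq₀ : q₀ ∈ L.D) (hF : F ≤ 𝓝[L.regular] q₀) (h0 : dt L.φ q₀ = 0) (hn0 : n q₀ ≠ 0) :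
    f =Θ[F] fun q => (dt L.φ q)⁻¹ := by
  have h1 : Tendsto (fun q => n q - r q * dt L.φ q) F (𝓝 (n q₀)) := by
    have := (tendsto_of_continuousOn hn hq₀ hF).sub ((tendsto_of_continuousOn hr hq₀ hF).mul
      (tendsto_of_continuousOn continuousOn_dt_φ hq₀ hF))
    rwa [h0, mul_zero, sub_zero] at this
  have h2 : f =ᶠ[F] fun q => (n q - r q * dt L.φ q) * (dt L.φ q)⁻¹ := by
    filter_upwards [hF self_mem_nhdsWithin] with q hq
    have := (mem_regular.1 hq).2
    rw [hf q hq]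
    field_simp
  have h3 : (fun q => n q - r q * dt L.φ q) =Θ[F] fun _ => (1 : ℝ) :=
    ((isEquivalent_const_iff_tendsto hn0).2 h1).isTheta.trans
      (isTheta_const_const hn0 one_ne_zero)
  have h4 := h3.mul (isTheta_refl (fun q => (dt L.φ q)⁻¹) F)
  simp only [one_mul] at h4
  exact h2.trans_isTheta h4

theorem tendsto_abs_of_isTheta {f : E3 × ℝ → ℝ} (hq₀ : q₀ ∈ L.D) (hF : F ≤ 𝓝[L.regular] q₀)
    (h0 : dt L.φ q₀ = 0) (hf : f =Θ[F] fun q => (dt L.φ q)⁻¹) :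
    Tendsto (fun q => |f q|) F atTop := by
  have h1 : Tendsto (dt L.φ) F (𝓝[≠] 0) := by
    refine tendsto_nhdsWithin_iff.2 ⟨?_, ?_⟩
    · have := tendsto_of_continuousOn continuousOn_dt_φ hq₀ hF
      rwa [h0] at this
    · filter_upwards [hF self_mem_nhdsWithin] with q hq using (mem_regular.1 hq).2
  have h2 : Tendsto (fun q => ‖(dt L.φ q)⁻¹‖) F atTop := tendsto_norm_inv_nhdsNE_zero_atTop.comp h1
  exact hf.tendsto_norm_atTop_iff.2 h2

end Asymptotic

end LegendrianFamily

end NSF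

/-! ### Equivalence of the two caustics. -/

theorem mainTheorem3
    (U : Set NSF.E3) (hU : IsOpen U) (g : NSF.LorentzMetric U)
    (L : NSF.LegendrianFamily) (hLU : ∀ q ∈ L.D, q.1 ∈ U)
    (Z : NSF.E3 × ℝ → NSF.E3 → ℝ → ℝ)
    (Λdom : Set (ℝ × ℝ × ℝ × ℝ)) (Λ : ℝ × ℝ × ℝ × ℝ → ℝ)
    (hZ : L.IsGeneralSolution Z Λdom Λ)
    (hnull : L.IsNull Z g)
    (q₀ : NSF.E3 × ℝ) (hq₀ : q₀ ∈ L.D) (hcut : (L.cutFilter q₀).NeBot) :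
    (L.CutCaustic Z q₀ ↔ L.SurfaceCaustic Z g q₀) ∧
    (L.CutCaustic Z q₀ → L.rho Z g =Θ[L.surfaceFilter q₀] L.secondDeriv Z) ∧
    (∀ F : Filter (NSF.E3 × ℝ), F.NeBot → F ≤ L.surfaceFilter q₀ →
      Tendsto (fun q => |L.rho Z g q|) F atTop → L.CutCaustic Z q₀) := by
  have hb := hZ.branches
  have hcutF : L.cutFilter q₀ ≤ 𝓝[L.regular] q₀ := nhdsWithin_mono _ inter_subset_right
  have hsurfF : L.surfaceFilter q₀ ≤ 𝓝[L.regular] q₀ := nhdsWithin_mono _ inter_subset_right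
  have hqc : q₀ ∈ closure L.regular := mem_closure_iff_nhdsWithin_neBot.2 (hcut.mono hcutF)
  have hπ : ContinuousOn (NSF.dt L.π) L.D :=
    (NSF.contDiffOn_dt L.isOpen_D L.smooth_π).continuousOn
  have hN := NSF.LegendrianFamily.continuousOn_poleCoeff (g := g) hLU
  have hR := NSF.LegendrianFamily.continuousOn_regularPart (g := g) hU hLU
  -- The term `- 0` puts `Z''` in the same form `n / ∂_t φ - r` as `ρ`, so the same asymptotic
  -- lemmas apply to both.
  have hr : ∀ q ∈ L.regular, L.secondDeriv Z q = NSF.dt L.π q / NSF.dt L.φ q - 0 :=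
    fun q hq => by rw [hb.secondDeriv_eq hq, sub_zero]
  have hρ : ∀ q ∈ L.regular, L.rho Z g q
      = L.poleCoeff g q / NSF.dt L.φ q - L.regularPart g q :=
    fun q hq => NSF.LegendrianFamily.rho_eq hU hLU hb hq
  have hrΘ : NSF.dt L.φ q₀ = 0 → ∀ F ≤ 𝓝[L.regular] q₀,
      L.secondDeriv Z =Θ[F] fun q => (NSF.dt L.φ q)⁻¹ := fun h0 F hF =>
    NSF.LegendrianFamily.isTheta_inv_dt_φ hπ continuousOn_const hr hq₀ hF h0
      (NSF.LegendrianFamily.dt_π_ne_zero hq₀ h0)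
  have hρΘ : NSF.dt L.φ q₀ = 0 → ∀ F ≤ 𝓝[L.regular] q₀,
      L.rho Z g =Θ[F] fun q => (NSF.dt L.φ q)⁻¹ := fun h0 F hF =>
    NSF.LegendrianFamily.isTheta_inv_dt_φ hN hR hρ hq₀ hF h0
      (NSF.LegendrianFamily.poleCoeff_ne_zero hLU hb hZ.independent hnull hq₀ hqc h0)
  have hcut_of : NSF.dt L.φ q₀ = 0 → L.CutCaustic Z q₀ := fun h0 =>
    ⟨hcut, NSF.LegendrianFamily.tendsto_abs_of_isTheta hq₀ hcutF h0 (hrΘ h0 _ hcutF)⟩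
  have of_cut : L.CutCaustic Z q₀ → NSF.dt L.φ q₀ = 0 := fun h =>
    NSF.LegendrianFamily.dt_φ_eq_zero_of_tendsto hπ continuousOn_const hr hq₀ hcutF h.2
  have of_rho : ∀ F : Filter (NSF.E3 × ℝ), F.NeBot → F ≤ L.surfaceFilter q₀ →
      Tendsto (fun q => |L.rho Z g q|) F atTop → NSF.dt L.φ q₀ = 0 := fun F _ hF h =>
    NSF.LegendrianFamily.dt_φ_eq_zero_of_tendsto hN hR hρ hq₀ (hF.trans hsurfF) h
  refine ⟨⟨fun h => ?_, fun h => hcut_of (of_rho _ h.1 le_rfl h.2)⟩, fun h => ?_,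
    fun F hF hFS h => hcut_of (of_rho F hF hFS h)⟩
  · have h0 := of_cut h
    exact ⟨NSF.LegendrianFamily.surfaceFilter_neBot hZ.independent hq₀ h0,
      NSF.LegendrianFamily.tendsto_abs_of_isTheta hq₀ hsurfF h0 (hρΘ h0 _ hsurfF)⟩
  · have h0 := of_cut h
    exact (hρΘ h0 _ hsurfF).trans (hrΘ h0 _ hsurfF).symm
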